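/- The *domination game* on a finite graph $G$ is played by two players, Dominator and Staller, who alternately choose a vertex of $G$; a chosen vertex dominates itself and its neighbours, and each chosen vertex must dominate at least one vertex not dominated by the previously chosen vertices. The game ends when all vertices are dominated. Dominator wants to minimize, and Staller to maximize, the number of moves. The *game domination number* $\gamma_g(G)$ is the number of moves when Dominator starts and both players play optimally. Write $n(G)$ for the number of vertices of $G$. For $m\ge 3$ and $n,k\ge 1$, the *two-tailed tadpole* $T_{m,n,k}$ is the graph obtained from the disjoint union of a cycle $C_m$ and paths $P_n$ and $P_k$ (on $m$, $n$ and $k$ vertices) by adding two edges without a common end-vertex, which join two adjacent vertices of $C_m$ with an end-vertex of $P_n$ and an end-vertex of $P_k$, respectively. **Theorem.** 1. If $m\ge 3$ and $n,k\ge 1$, then $\gamma_g(T_{m,n,k})\le\left\lceil\frac{n(T_{m,n,k})}{2}\right\rceil$. 2. If $G$ is a finite unicyclic graph (that is, connected with exactly one cycle) that is traceable (that is, it contains a Hamiltonian path), then $\gamma_g(G)\le\left\lceil\frac{n(G)}{2}\right\rceil$. -/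

import Mathlib

namespace DominationGame

/-- The closed neighbourhood of `v`, that is, the set of vertices dominated by `v`. -/
def closedNeighborSet {V : Type*} (G : SimpleGraph V) (v : V) : Set V :=
  insert v (G.neighborSet v)

/-- If the vertices of `D` are already dominated, then playing `v` is legal when
`v` dominates at least one vertex that is not yet dominated. -/
def IsLegalMove {V : Type*} (G : SimpleGraph V) (D : Set V) (v : V) : Prop :=
  ∃ w ∈ closedNeighborSet G v, w ∉ D

/-- The two players of the domination game. -/
inductive Player where
  | dominator
  | staller

theorem ncard_compl_lt {V : Type*} [Finite V] {G : SimpleGraph V} {D : Set V} {v : V}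
    (h : IsLegalMove G D v) : (D ∪ closedNeighborSet G v)ᶜ.ncard < Dᶜ.ncard := by
  obtain ⟨w, hw, hD⟩ := h
  refine Set.ncard_lt_ncard ⟨?_, fun hs => ?_⟩ (Set.toFinite _)
  · exact Set.compl_subset_compl.mpr Set.subset_union_left
  · exact hs hD (Or.inr hw)

open Classical in
/-- The number of moves still to be made in the domination game on the partially dominated
graph `G | D` when the given player moves next and both players play optimally: the players
alternately make legal moves until all vertices are dominated, Dominator minimizes and
Staller maximizes the number of moves. As long as some vertex is undominated
there is a legal move (play that vertex), so the infimum and the supremum below range over a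
nonempty finite set, and are a minimum and a maximum. -/
noncomputable def gameLength {V : Type*} [Finite V] (G : SimpleGraph V) :
    Player → Set V → ℕ
  | .dominator, D =>
      if D = Set.univ then 0
      else 1 + ⨅ v : {v : V // IsLegalMove G D v},
        gameLength G .staller (D ∪ closedNeighborSet G v)
  | .staller, D =>
      if D = Set.univ then 0
      else 1 + ⨆ v : {v : V // IsLegalMove G D v},
        gameLength G .dominator (D ∪ closedNeighborSet G v)
termination_by _ D => Dᶜ.ncard
decreasing_by
  all_goals exact ncard_compl_lt v.2

/-- The game domination number `γ_g(G)`: no vertex is dominated at the start, and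
Dominator moves first. -/
noncomputable def gameDominationNumber {V : Type*} [Finite V] (G : SimpleGraph V) : ℕ :=
  gameLength G .dominator ∅

/-- The two-tailed tadpole `T_{m,n,k}` (for `m ≥ 3` and `n, k ≥ 1`): the disjoint union of a
cycle `C_m` and paths `P_n`, `P_k`, plus an edge between the vertex `0` of the cycle and the
end-vertex `0` of `P_n`, and an edge between the vertex `1` of the cycle
(adjacent to `0` on the cycle) and the end-vertex `0` of `P_k`. -/
def twoTailedTadpole (m n k : ℕ) : SimpleGraph (Fin m ⊕ Fin n ⊕ Fin k) :=
  (SimpleGraph.cycleGraph m ⊕g (SimpleGraph.pathGraph n ⊕g SimpleGraph.pathGraph k)) ⊔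
    SimpleGraph.fromRel fun x y =>
      match x, y with
      | .inl i, .inr (.inl j) => i.val = 0 ∧ j.val = 0
      | .inl i, .inr (.inr j) => i.val = 1 ∧ j.val = 0
      | _, _ => False

/-- A graph is traceable if it contains a Hamiltonian path. -/
def IsTraceable {V : Type*} (G : SimpleGraph V) : Prop :=
  open Classical in ∃ (a b : V) (p : G.Walk a b), p.IsHamiltonian

/-- A graph is unicyclic if it is connected and contains exactly one cycle. Cycles are
identified when they have the same edges (a cycle subgraph gives several closed walks, one for
each starting vertex and direction). -/
def IsUnicyclic {V : Type*} (G : SimpleGraph V) : Prop :=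
  G.Connected ∧
    ∃! C : Set (Sym2 V), ∃ (v : V) (p : G.Walk v v), p.IsCycle ∧ {e | e ∈ p.edges} = C

end DominationGame

namespace DominationGame

/-! ### The game recursion and the continuation principle -/

section Basic

variable {V : Type*} {G : SimpleGraph V}

/-! Both kinds of graph consist of a Hamiltonian path on `N` vertices plus at most one chord,
joining the labels `i` and `j`. Once both ends of the chord are dominated, the chord no longer helps
anyone and the game is played on a path. There the undominated vertices form runs. Charge a run of
length `r` with `r` if `4 ∣ r` and with `r + 1` otherwise. With Staller to move, at most half the
total charge, rounded up, moves remain (`IsPathLabelling.gameLength_staller_le`): Staller cannot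
raise the charge, and if it stays the same, a run of length 3 mod 4 appears, from which Dominator
takes 4 units at once. If it falls to an odd value, some run has length 2 mod 4, and Dominator takes
3; if it falls to an even value, rounding has paid for Staller's move and any reply of Dominator
takes 2.

With a chord, Dominator usually opens at one of its ends, which kills the chord and leaves at most
three runs. This suffices if `N` is odd, or if one of the runs has length divisible by 4, where the
two runs around the other end may also be counted as one. The residues that survive this for both
ends call for a different opening: Dominator cuts off, just before `i`, a run of length divisible by
4 and leaves the chord alive. In `IsPathLabelling.gameLength_staller_le_of_region` the part
containing the chord is a region in which Dominator can answer every move of Staller and also has a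
useful spare move. -/

theorem exists_isLegalMove {D : Set V} (h : D ≠ Set.univ) : ∃ v, IsLegalMove G D v := by
  obtain ⟨v, hv⟩ := (Set.ne_univ_iff_exists_notMem D).1 h
  exact ⟨v, v, Set.mem_insert _ _, hv⟩

theorem IsLegalMove.anti {A B : Set V} (hAB : A ⊆ B) {v : V} (h : IsLegalMove G B v) :
    IsLegalMove G A v := by
  obtain ⟨w, hw, hB⟩ := h
  exact ⟨w, hw, fun hA => hB (hAB hA)⟩

variable [Finite V]

theorem gameLength_univ (p : Player) : gameLength G p Set.univ = 0 := by
  cases p <;> rw [gameLength] <;> simp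

theorem gameLength_staller_le {D : Set V} {b : ℕ}
    (h : ∀ v, IsLegalMove G D v →
      1 + gameLength G .dominator (D ∪ closedNeighborSet G v) ≤ b) :
    gameLength G .staller D ≤ b := by
  by_cases hD : D = Set.univ
  · subst hD
    rw [gameLength_univ]
    exact Nat.zero_le _
  rw [gameLength, if_neg hD]
  obtain ⟨v₀, hv₀⟩ := exists_isLegalMove (G := G) hD
  have : Nonempty {v : V // IsLegalMove G D v} := ⟨⟨v₀, hv₀⟩⟩
  obtain ⟨v, hv⟩ := exists_eq_ciSup_of_finite
    (f := fun v : {v : V // IsLegalMove G D v} =>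
      gameLength G .dominator (D ∪ closedNeighborSet G v))
  rw [← hv]
  exact h v v.2

theorem le_gameLength_staller {D : Set V} {v : V} (hv : IsLegalMove G D v) :
    1 + gameLength G .dominator (D ∪ closedNeighborSet G v) ≤ gameLength G .staller D := by
  have hD : D ≠ Set.univ := by
    rintro rfl
    obtain ⟨w, -, hw⟩ := hv
    exact hw trivial
  rw [gameLength.eq_def G .staller D]
  simp only [if_neg hD]
  gcongr
  exact le_ciSup (f := fun v : {v : V // IsLegalMove G D v} =>
      gameLength G .dominator (D ∪ closedNeighborSet G v)) (Set.finite_range _).bddAbove ⟨v, hv⟩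

theorem gameLength_dominator_le_of_isLegalMove {D : Set V} {v : V} (hv : IsLegalMove G D v) :
    gameLength G .dominator D ≤ 1 + gameLength G .staller (D ∪ closedNeighborSet G v) := by
  have hD : D ≠ Set.univ := by
    rintro rfl
    obtain ⟨w, -, hw⟩ := hv
    exact hw trivial
  rw [gameLength, if_neg hD]
  gcongr
  exact ciInf_le' (fun v : {v : V // IsLegalMove G D v} =>
      gameLength G .staller (D ∪ closedNeighborSet G v)) ⟨v, hv⟩

theorem exists_gameLength_dominator_eq {D : Set V} (hD : D ≠ Set.univ) :
    ∃ v, IsLegalMove G D v ∧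
      gameLength G .dominator D = 1 + gameLength G .staller (D ∪ closedNeighborSet G v) := by
  obtain ⟨v₀, hv₀⟩ := exists_isLegalMove (G := G) hD
  have : Nonempty {v : V // IsLegalMove G D v} := ⟨⟨v₀, hv₀⟩⟩
  obtain ⟨v, hv⟩ := exists_eq_ciInf_of_finite
    (f := fun v : {v : V // IsLegalMove G D v} =>
      gameLength G .staller (D ∪ closedNeighborSet G v))
  refine ⟨v, v.2, ?_⟩
  rw [gameLength, if_neg hD, ← hv]

/-- The continuation principle: dominating more vertices in advance does not prolong the game. -/
theorem gameLength_anti (p : Player) {A B : Set V} (hAB : A ⊆ B) :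
    gameLength G p B ≤ gameLength G p A := by
  induction hn : Aᶜ.ncard using Nat.strong_induction_on generalizing p A B with
  | _ n ih =>
    subst hn
    cases p with
    | staller =>
      refine gameLength_staller_le fun v hv => ?_
      refine le_trans ?_ (le_gameLength_staller (hv.anti hAB))
      gcongr 1 + ?_
      exact ih _ (ncard_compl_lt (hv.anti hAB)) _ (Set.union_subset_union_left _ hAB) rfl
    | dominator =>
      by_cases hB : B = Set.univ
      · subst hB
        rw [gameLength_univ]
        exact Nat.zero_le _
      have hA : A ≠ Set.univ := fun h => hB (Set.univ_subset_iff.1 (h ▸ hAB))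
      obtain ⟨v, hv, he⟩ := exists_gameLength_dominator_eq (G := G) hA
      rw [he]
      by_cases hvB : IsLegalMove G B v
      · refine (gameLength_dominator_le_of_isLegalMove hvB).trans ?_
        gcongr 1 + ?_
        exact ih _ (ncard_compl_lt hv) _ (Set.union_subset_union_left _ hAB) rfl
      -- The move that is optimal from `A` adds nothing to `B`, so any legal move from `B` does at
      -- least as well.
      · have hsub : closedNeighborSet G v ⊆ B := by
          intro w hw
          by_contra hwB
          exact hvB ⟨w, hw, hwB⟩
        obtain ⟨u, hu⟩ := exists_isLegalMove (G := G) hB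
        refine (gameLength_dominator_le_of_isLegalMove hu).trans ?_
        gcongr 1 + ?_
        exact ih _ (ncard_compl_lt hv) _
          ((Set.union_subset hAB hsub).trans Set.subset_union_left) rfl

/-- Dominator may pretend to play any vertex, even if this is not a legal move. -/
theorem gameLength_dominator_le (D : Set V) (v : V) :
    gameLength G .dominator D ≤ 1 + gameLength G .staller (D ∪ closedNeighborSet G v) := by
  by_cases hv : IsLegalMove G D v
  · exact gameLength_dominator_le_of_isLegalMove hv
  have hsub : closedNeighborSet G v ⊆ D := by
    intro w hw
    by_contra hwD
    exact hv ⟨w, hw, hwD⟩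
  by_cases hD : D = Set.univ
  · subst hD
    rw [gameLength_univ]
    exact Nat.zero_le _
  obtain ⟨u, hu⟩ := exists_isLegalMove (G := G) hD
  refine (gameLength_dominator_le_of_isLegalMove hu).trans ?_
  gcongr 1 + ?_
  exact gameLength_anti _ (Set.union_subset Set.subset_union_left
    (hsub.trans Set.subset_union_left))

end Basic

/-! ### Hamiltonian labellings, runs and their cost -/

/-- A labelling of the vertices by `0, …, N - 1` along a Hamiltonian path. -/
structure IsPathLabelling {V : Type*} (G : SimpleGraph V) (φ : V → ℕ) (N : ℕ) : Prop where
  injective : Function.Injective φ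
  lt (v : V) : φ v < N
  exists_eq {k : ℕ} (hk : k < N) : ∃ v, φ v = k
  adj {u v : V} (h : φ u + 1 = φ v) : G.Adj u v

/-- Once the vertices of `D` are dominated, a vertex can only dominate new vertices which are close
to it on the labelled path. -/
def IsPathLike {V : Type*} (G : SimpleGraph V) (φ : V → ℕ) (D : Set V) : Prop :=
  ∀ ⦃v w⦄, w ∈ closedNeighborSet G v → w ∉ D → φ w ≤ φ v + 1 ∧ φ v ≤ φ w + 1

/-- The labels of the vertices of `U` lie in the intervals `[l, h)`, `(l, h) ∈ L`. -/
structure Covers {V : Type*} (φ : V → ℕ) (N : ℕ) (U : Set V) (L : Multiset (ℕ × ℕ)) : Prop where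
  exists_mem {v : V} (hv : v ∈ U) : ∃ I ∈ L, I.1 ≤ φ v ∧ φ v < I.2
  le {I : ℕ × ℕ} (hI : I ∈ L) : I.2 ≤ N

/-- Twice the number of moves which a run of `r` undominated vertices is worth. -/
def runCost (r : ℕ) : ℕ := r + (r % 4 + 3) / 4

/-- The total cost of a multiset of intervals. -/
def cost (L : Multiset (ℕ × ℕ)) : ℕ := (L.map fun I => runCost (I.2 - I.1)).sum

@[simp] theorem cost_zero : cost 0 = 0 := rfl

@[simp] theorem cost_cons (I : ℕ × ℕ) (L : Multiset (ℕ × ℕ)) :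
    cost (I ::ₘ L) = runCost (I.2 - I.1) + cost L := by
  simp [cost]

@[simp] theorem cost_singleton (I : ℕ × ℕ) : cost {I} = runCost (I.2 - I.1) := by
  simp [cost]

@[simp] theorem cost_add (L L' : Multiset (ℕ × ℕ)) : cost (L + L') = cost L + cost L' := by
  simp [cost]

theorem runCost_mod_two {r : ℕ} (h : r % 4 ≠ 2) : runCost r % 2 = 0 := by
  have : r % 4 = 0 ∨ r % 4 = 1 ∨ r % 4 = 3 := by omega
  rw [runCost]
  rcases this with h | h | h <;> rw [h] <;> omega

/-- The effect of one move of Staller on a run. -/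
theorem runCost_split {r s t : ℕ}
    (h : s + t + 3 = r ∨ (s = 0 ∨ t = 0) ∧ (s + t + 1 = r ∨ s + t + 2 = r)) :
    runCost s + runCost t ≤ runCost r ∧ 2 ≤ runCost r ∧
      (runCost s + runCost t = runCost r → s % 4 = 3 ∨ t % 4 = 3) := by
  simp only [runCost]
  have hs : s % 4 = 0 ∨ s % 4 = 1 ∨ s % 4 = 2 ∨ s % 4 = 3 := by omega
  have ht : t % 4 = 0 ∨ t % 4 = 1 ∨ t % 4 = 2 ∨ t % 4 = 3 := by omega
  rcases hs with hs | hs | hs | hs <;> rcases ht with ht | ht | ht | ht <;>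
    rw [hs, ht] <;> omega

/-- Only lengths 2 mod 4 have odd cost, so parity of the total detects such a run. -/
theorem exists_mod_four_eq_two {L : Multiset (ℕ × ℕ)} (h : cost L % 2 = 1) :
    ∃ I ∈ L, (I.2 - I.1) % 4 = 2 := by
  induction L using Multiset.induction_on with
  | empty => simp at h
  | cons I L ih =>
    by_cases hI : (I.2 - I.1) % 4 = 2
    · exact ⟨I, Multiset.mem_cons_self _ _, hI⟩
    · have heven := runCost_mod_two hI
      rw [cost_cons] at h
      obtain ⟨J, hJ, hJ2⟩ := ih (by omega)
      exact ⟨J, Multiset.mem_cons_of_mem hJ, hJ2⟩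

theorem exists_lt_of_cost_pos {L : Multiset (ℕ × ℕ)} (h : 0 < cost L) :
    ∃ I ∈ L, I.1 < I.2 := by
  induction L using Multiset.induction_on with
  | empty => simp at h
  | cons I L ih =>
    by_cases hI : I.1 < I.2
    · exact ⟨I, Multiset.mem_cons_self _ _, hI⟩
    · have : I.2 - I.1 = 0 := by omega
      rw [cost_cons, this, runCost] at h
      obtain ⟨J, hJ, hJ2⟩ := ih (by omega)
      exact ⟨J, Multiset.mem_cons_of_mem hJ, hJ2⟩

theorem eq_zero_of_cost_eq_zero {L : Multiset (ℕ × ℕ)} (h : cost L = 0) {I : ℕ × ℕ} (hI : I ∈ L) :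
    ¬ I.1 < I.2 := by
  obtain ⟨s, rfl⟩ := Multiset.exists_cons_of_mem hI
  rw [cost_cons, runCost] at h
  omega

namespace Covers

variable {V : Type*} {φ : V → ℕ} {N : ℕ} {U U' : Set V} {L L' : Multiset (ℕ × ℕ)}

theorem mono (h : Covers φ N U L) (hU : U' ⊆ U) : Covers φ N U' L :=
  ⟨fun hv => h.exists_mem (hU hv), h.le⟩

theorem union (h : Covers φ N U L) (h' : Covers φ N U' L') : Covers φ N (U ∪ U') (L + L') := by
  refine ⟨?_, fun hI => ?_⟩
  · rintro v (hv | hv)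
    · obtain ⟨I, hI, hv⟩ := h.exists_mem hv
      exact ⟨I, Multiset.mem_add.2 (Or.inl hI), hv⟩
    · obtain ⟨I, hI, hv⟩ := h'.exists_mem hv
      exact ⟨I, Multiset.mem_add.2 (Or.inr hI), hv⟩
  · rcases Multiset.mem_add.1 hI with hI | hI
    exacts [h.le hI, h'.le hI]

end Covers

/-! ### The game on runs once the chord is harmless -/

section Moves

variable {V : Type*} {G : SimpleGraph V} {φ : V → ℕ} {N : ℕ}

theorem IsPathLike.mono {D D' : Set V} (h : IsPathLike G φ D) (hD : D ⊆ D') :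
    IsPathLike G φ D' :=
  fun _ _ hw hwD => h hw fun h' => hwD (hD h')

theorem IsPathLabelling.mem_closedNeighborSet (hφ : IsPathLabelling G φ N) {u v : V}
    (h₁ : φ u ≤ φ v + 1) (h₂ : φ v ≤ φ u + 1) : u ∈ closedNeighborSet G v := by
  rcases lt_trichotomy (φ u) (φ v) with h | h | h
  · exact Or.inr (hφ.adj (by omega)).symm
  · exact Or.inl (hφ.injective h)
  · exact Or.inr (hφ.adj (by omega))

/-- Dominator removes the first three vertices of the run. The gain depends on the residue of the
length: at least 2 always, 3 for residue 2 and 4 for residue 3. -/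
theorem IsPathLabelling.dominator_step (hφ : IsPathLabelling G φ N) {U : Set V}
    {L : Multiset (ℕ × ℕ)} (hL : Covers φ N U L) {I : ℕ × ℕ} (hI : I ∈ L) (hlt : I.1 < I.2) :
    ∃ p L', Covers φ N (U \ closedNeighborSet G p) L' ∧
      cost L' + 2 ≤ cost L ∧ cost L' + ((I.2 - I.1) % 4 + 1) ≤ cost L := by
  obtain ⟨s, rfl⟩ := Multiset.exists_cons_of_mem hI
  obtain ⟨l, h⟩ := I
  have hN : h ≤ N := hL.le hI
  dsimp only at hlt ⊢
  -- The middle of the first three vertices. In a run shorter than 3 the first vertex is enough,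
  -- whereas label `l + 1` might not exist.
  obtain ⟨p, hp⟩ := hφ.exists_eq (k := if h - l < 3 then l else l + 1) (by split_ifs <;> omega)
  refine ⟨p, (l + 3, h) ::ₘ s, ⟨fun {u} hu => ?_, fun {J} hJ => ?_⟩, ?_, ?_⟩
  · obtain ⟨J, hJ, hJu⟩ := hL.exists_mem hu.1
    rcases Multiset.mem_cons.1 hJ with rfl | hJ
    · refine ⟨_, Multiset.mem_cons_self _ _, ?_⟩
      by_contra hcon
      refine hu.2 (hφ.mem_closedNeighborSet ?_ ?_) <;> dsimp only at hcon hJu <;>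
        split_ifs at hp <;> omega
    · exact ⟨J, Multiset.mem_cons_of_mem hJ, hJu⟩
  · rcases Multiset.mem_cons.1 hJ with rfl | hJ
    · exact hN
    · exact hL.le (Multiset.mem_cons_of_mem hJ)
  all_goals
    rw [cost_cons, cost_cons, runCost, runCost]
    dsimp only
    omega

theorem IsPathLabelling.staller_step (hφ : IsPathLabelling G φ N) {U : Set V}
    {L : Multiset (ℕ × ℕ)} (hL : Covers φ N U L) {v w : V} (hw : w ∈ U)
    (h₁ : φ w ≤ φ v + 1) (h₂ : φ v ≤ φ w + 1) :
    ∃ L', Covers φ N (U \ closedNeighborSet G v) L' ∧ cost L' ≤ cost L ∧ 2 ≤ cost L ∧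
      (cost L' = cost L → ∃ I ∈ L', (I.2 - I.1) % 4 = 3) := by
  obtain ⟨I, hI, hwI⟩ := hL.exists_mem hw
  obtain ⟨s, rfl⟩ := Multiset.exists_cons_of_mem hI
  obtain ⟨l, h⟩ := I
  have hN : h ≤ N := hL.le hI
  dsimp only at hwI
  have key : runCost (φ v - 1 - l) + runCost (h - (φ v + 2)) ≤ runCost (h - l) ∧
      2 ≤ runCost (h - l) ∧
      (runCost (φ v - 1 - l) + runCost (h - (φ v + 2)) = runCost (h - l) →
        (φ v - 1 - l) % 4 = 3 ∨ (h - (φ v + 2)) % 4 = 3) :=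
    runCost_split (by omega)
  -- If `v` is at an end of the run or just outside it, truncated subtraction makes one of the two
  -- pieces empty.
  refine ⟨(l, φ v - 1) ::ₘ (φ v + 2, h) ::ₘ s, ⟨fun {u} hu => ?_, fun {J} hJ => ?_⟩, ?_, ?_, ?_⟩
  · obtain ⟨J, hJ, hJu⟩ := hL.exists_mem hu.1
    rcases Multiset.mem_cons.1 hJ with rfl | hJ
    · by_cases hlt : φ u < φ v
      · refine ⟨_, Multiset.mem_cons_self _ _, ?_⟩
        by_contra hcon
        exact hu.2 (hφ.mem_closedNeighborSet (by omega) (by dsimp only at hcon hJu; omega))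
      · refine ⟨_, Multiset.mem_cons_of_mem (Multiset.mem_cons_self _ _), ?_⟩
        by_contra hcon
        exact hu.2 (hφ.mem_closedNeighborSet (by dsimp only at hcon hJu; omega) (by omega))
    · exact ⟨J, Multiset.mem_cons_of_mem (Multiset.mem_cons_of_mem hJ), hJu⟩
  · rcases Multiset.mem_cons.1 hJ with rfl | hJ
    · dsimp only
      omega
    rcases Multiset.mem_cons.1 hJ with rfl | hJ
    · exact hN
    · exact hL.le (Multiset.mem_cons_of_mem hJ)
  · simp only [cost_cons]
    omega
  · simp only [cost_cons]
    omega
  · intro heq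
    simp only [cost_cons] at heq
    rcases key.2.2 (by omega) with hm | hm
    · exact ⟨_, Multiset.mem_cons_self _ _, hm⟩
    · exact ⟨_, Multiset.mem_cons_of_mem (Multiset.mem_cons_self _ _), hm⟩

/-- After a move of Staller on the intervals, either Dominator has a reply such that the two moves
are paid for, or the move of Staller was already paid for. -/
theorem IsPathLabelling.staller_round (hφ : IsPathLabelling G φ N) {U : Set V}
    {L : Multiset (ℕ × ℕ)} (hL : Covers φ N U L) {v w : V} (hw : w ∈ U)
    (h₁ : φ w ≤ φ v + 1) (h₂ : φ v ≤ φ w + 1) :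
    ∃ L', Covers φ N (U \ closedNeighborSet G v) L' ∧
      ((∃ p L'', Covers φ N ((U \ closedNeighborSet G v) \ closedNeighborSet G p) L'' ∧
          (cost L'' + 1) / 2 + 2 ≤ (cost L + 1) / 2) ∨
        (cost L' + 1) / 2 + 1 ≤ (cost L + 1) / 2) := by
  obtain ⟨L', hL', hle, h2, heq⟩ := hφ.staller_step hL hw h₁ h₂
  refine ⟨L', hL', ?_⟩
  rcases hle.eq_or_lt with he | hlt
  · obtain ⟨I, hI, hI3⟩ := heq he
    obtain ⟨p, L'', hL'', -, hc⟩ := hφ.dominator_step hL' hI (by omega)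
    exact Or.inl ⟨p, L'', hL'', by omega⟩
  · by_cases hodd : cost L' % 2 = 1
    · obtain ⟨I, hI, hI2⟩ := exists_mod_four_eq_two hodd
      obtain ⟨p, L'', hL'', -, hc⟩ := hφ.dominator_step hL' hI (by omega)
      exact Or.inl ⟨p, L'', hL'', by omega⟩
    -- The new cost is even and strictly smaller, so the rounded half has already dropped by one.
    · exact Or.inr (by omega)

variable [Finite V]

/-- The value of a position in which the chord does not matter any more, with Staller to move. -/
theorem IsPathLabelling.gameLength_staller_le (hφ : IsPathLabelling G φ N) {D : Set V}
    (hD : IsPathLike G φ D) {L : Multiset (ℕ × ℕ)} (hL : Covers φ N Dᶜ L) :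
    gameLength G .staller D ≤ (cost L + 1) / 2 := by
  induction hn : Dᶜ.ncard using Nat.strong_induction_on generalizing D L with
  | _ n ih =>
    subst hn
    refine DominationGame.gameLength_staller_le fun v hv => ?_
    obtain ⟨w, hwv, hwD⟩ := id hv
    have reply : ∀ p L'', Covers φ N ((Dᶜ \ closedNeighborSet G v) \ closedNeighborSet G p) L'' →
        gameLength G .dominator (D ∪ closedNeighborSet G v) ≤ 1 + (cost L'' + 1) / 2 := by
      intro p L'' hL''
      refine (gameLength_dominator_le _ p).trans (Nat.add_le_add_left ?_ 1)
      refine ih _ ?_ (hD.mono ?_) ?_ rfl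
      · exact (Set.ncard_le_ncard (Set.compl_subset_compl.2 Set.subset_union_left)
          (Set.toFinite _)).trans_lt (ncard_compl_lt hv)
      · exact Set.subset_union_left.trans Set.subset_union_left
      · refine hL''.mono fun u hu => ?_
        simp only [Set.mem_compl_iff, Set.mem_union, not_or] at hu
        exact ⟨⟨hu.1.1, hu.1.2⟩, hu.2⟩
    obtain ⟨L', hL', ⟨p, L'', hL'', hc⟩ | hc⟩ :=
      hφ.staller_round hL hwD (hD hwv hwD).1 (hD hwv hwD).2
    · have := reply p L'' hL''
      omega
    · rcases Nat.eq_zero_or_pos (cost L') with h0 | hpos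
      · have : D ∪ closedNeighborSet G v = Set.univ := by
          refine Set.eq_univ_of_forall fun u => ?_
          by_contra hu
          simp only [Set.mem_union, not_or] at hu
          obtain ⟨I, hI, hIu⟩ := hL'.exists_mem ⟨hu.1, hu.2⟩
          exact eq_zero_of_cost_eq_zero h0 hI (by omega)
        rw [this, gameLength_univ]
        omega
      · obtain ⟨I, hI, hlt⟩ := exists_lt_of_cost_pos hpos
        obtain ⟨p, L'', hL'', hc', -⟩ := hφ.dominator_step hL' hI hlt
        have := reply p L'' hL''
        omega

/-- The value of a position with Staller to move, where the labels from `z` on form a region for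
which Dominator has suitable replies to all moves of Staller, and a spare move. -/
theorem IsPathLabelling.gameLength_staller_le_of_region (hφ : IsPathLabelling G φ N) {D₀ : Set V}
    {z ω : ℕ} (hω : ω % 2 = 0)
    (hz : ∀ ⦃v w⦄, w ∈ closedNeighborSet G v → φ w < z → w ∉ D₀ → φ w ≤ φ v + 1 ∧ φ v ≤ φ w + 1)
    (hspare : ∃ p t, Covers φ N ({u | z ≤ φ u} \ closedNeighborSet G p) t ∧ cost t + 2 ≤ ω ∧
      IsPathLike G φ (D₀ ∪ closedNeighborSet G p))
    (hreply : ∀ v w, w ∈ closedNeighborSet G v → z ≤ φ w → ∃ p t,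
      Covers φ N (({u | z ≤ φ u} \ closedNeighborSet G v) \ closedNeighborSet G p) t ∧
      cost t + 4 ≤ ω ∧ IsPathLike G φ (D₀ ∪ closedNeighborSet G v ∪ closedNeighborSet G p))
    {D : Set V} (hD : D₀ ⊆ D) {s : Multiset (ℕ × ℕ)} (hs : Covers φ N {u | u ∉ D ∧ φ u < z} s) :
    gameLength G .staller D ≤ (cost s + 1) / 2 + ω / 2 := by
  induction hn : Dᶜ.ncard using Nat.strong_induction_on generalizing D s with
  | _ n ih =>
    subst hn
    refine DominationGame.gameLength_staller_le fun v hv => ?_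
    obtain ⟨w, hwv, hwD⟩ := id hv
    by_cases hwz : z ≤ φ w
    -- The reply makes the whole position path-like, so the bound for runs applies to `s + t`. As
    -- `ω` is even, the two halves add up without rounding loss.
    · obtain ⟨p, t, ht, hc, hlike⟩ := hreply v w hwv hwz
      have h1 := gameLength_dominator_le (G := G) (D ∪ closedNeighborSet G v) p
      have h2 := hφ.gameLength_staller_le (D := D ∪ closedNeighborSet G v ∪ closedNeighborSet G p)
        (L := s + t) (hlike.mono (by gcongr)) <| (hs.union ht).mono fun u hu => by
          simp only [Set.mem_compl_iff, Set.mem_union, not_or] at hu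
          rcases lt_or_ge (φ u) z with h | h
          · exact Or.inl ⟨hu.1.1, h⟩
          · exact Or.inr ⟨⟨h, hu.1.2⟩, hu.2⟩
      rw [cost_add] at h2
      omega
    · have hclose := hz hwv (by omega) fun h => hwD (hD h)
      obtain ⟨s', hs', ⟨p, s'', hs'', hc⟩ | hc⟩ :=
        hφ.staller_round hs (v := v) (w := w) ⟨hwD, by omega⟩ hclose.1 hclose.2
      · have h1 := gameLength_dominator_le (G := G) (D ∪ closedNeighborSet G v) p
        have h2 := ih (D ∪ closedNeighborSet G v ∪ closedNeighborSet G p)ᶜ.ncard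
          ((Set.ncard_le_ncard (Set.compl_subset_compl.2 Set.subset_union_left)
            (Set.toFinite _)).trans_lt (ncard_compl_lt hv))
          (hD.trans (Set.subset_union_left.trans Set.subset_union_left)) (s := s'')
          (hs''.mono fun u hu => by
            simp only [Set.mem_union, not_or, Set.mem_ofPred_eq] at hu
            exact ⟨⟨⟨hu.1.1.1, hu.2⟩, hu.1.1.2⟩, hu.1.2⟩) rfl
        omega
      -- Staller's move outside the region has paid for itself, so Dominator is free to use the
      -- spare move, which also disposes of the chord.
      · obtain ⟨p, t, ht, hc', hlike⟩ := hspare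
        have h1 := gameLength_dominator_le (G := G) (D ∪ closedNeighborSet G v) p
        have h2 := hφ.gameLength_staller_le
          (D := D ∪ closedNeighborSet G v ∪ closedNeighborSet G p)
          (L := s' + t) (hlike.mono (by gcongr; exact hD.trans Set.subset_union_left)) <|
            (hs'.union ht).mono fun u hu => by
              simp only [Set.mem_compl_iff, Set.mem_union, not_or] at hu
              rcases lt_or_ge (φ u) z with h | h
              · exact Or.inl ⟨⟨hu.1.1, h⟩, hu.1.2⟩
              · exact Or.inr ⟨h, hu.2⟩
        rw [cost_add] at h2
        omega

end Moves

/-! ### A path with one chord -/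

/-- The only edges which do not join vertices with consecutive labels join the labels `i`, `j`. -/
structure IsChord {V : Type*} (G : SimpleGraph V) (φ : V → ℕ) (i j : ℕ) : Prop where
  adj {u v : V} (hu : φ u = i) (hv : φ v = j) : G.Adj u v
  eq_of_adj {u v : V} (h : G.Adj u v) :
    φ u + 1 = φ v ∨ φ v + 1 = φ u ∨ (φ u = i ∧ φ v = j) ∨ (φ u = j ∧ φ v = i)

section Chord

variable {V : Type*} {G : SimpleGraph V} {φ : V → ℕ} {N i j : ℕ}

theorem IsChord.mem_closedNeighborSet_iff (hc : IsChord G φ i j) (hφ : IsPathLabelling G φ N)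
    {u v : V} : u ∈ closedNeighborSet G v ↔
      (φ u ≤ φ v + 1 ∧ φ v ≤ φ u + 1) ∨ (φ v = i ∧ φ u = j) ∨ (φ v = j ∧ φ u = i) := by
  constructor
  · rintro (rfl | h)
    · exact Or.inl (by omega)
    · rcases hc.eq_of_adj h with h | h | h | h
      · exact Or.inl (by omega)
      · exact Or.inl (by omega)
      · exact Or.inr (Or.inl h)
      · exact Or.inr (Or.inr h)
  · rintro (h | h | h)
    · exact hφ.mem_closedNeighborSet h.1 h.2
    · exact Or.inr (hc.adj h.1 h.2)
    · exact Or.inr (hc.adj h.2 h.1).symm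

theorem IsChord.isPathLike (hc : IsChord G φ i j) (hφ : IsPathLabelling G φ N) {D : Set V}
    (hD : ∀ u, φ u = i ∨ φ u = j → u ∈ D) : IsPathLike G φ D := by
  intro v w hw hwD
  have := mt (hD w) hwD
  rcases (hc.mem_closedNeighborSet_iff hφ).1 hw with h | h | h
  · exact h
  · exact absurd (Or.inr h.2) this
  · exact absurd (Or.inl h.2) this

/-- Used when Staller's own move has already made the chord harmless: Dominator then just plays in a
run, gaining either the guaranteed 2 or the larger amount given by the residue. -/
theorem IsPathLabelling.exists_reply (hφ : IsPathLabelling G φ N) {D U : Set V} {ω : ℕ}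
    {L : Multiset (ℕ × ℕ)} (hL : Covers φ N U L) (hD : IsPathLike G φ D)
    (h : ∃ I ∈ L, I.1 < I.2 ∧
      (cost L + 2 ≤ ω ∨ cost L + 4 ≤ ω + ((I.2 - I.1) % 4 + 1))) :
    ∃ p t, Covers φ N (U \ closedNeighborSet G p) t ∧ cost t + 4 ≤ ω ∧
      IsPathLike G φ (D ∪ closedNeighborSet G p) := by
  obtain ⟨I, hI, hlt, hcost⟩ := h
  obtain ⟨p, t, ht, h₁, h₂⟩ := hφ.dominator_step hL hI hlt
  exact ⟨p, t, ht, by omega, hD.mono Set.subset_union_left⟩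

theorem covers_pair {U : Set V} {I J : ℕ × ℕ} (hI : I.2 ≤ N) (hJ : J.2 ≤ N)
    (h : ∀ u ∈ U, (I.1 ≤ φ u ∧ φ u < I.2) ∨ (J.1 ≤ φ u ∧ φ u < J.2)) :
    Covers φ N U {I, J} := by
  refine ⟨fun {u} hu => ?_, fun {K} hK => ?_⟩
  · rcases h u hu with h | h
    exacts [⟨I, by simp, h⟩, ⟨J, by simp, h⟩]
  · have : K = I ∨ K = J := by simpa using hK
    rcases this with rfl | rfl <;> assumption

theorem covers_triple {U : Set V} {I J K : ℕ × ℕ} (hI : I.2 ≤ N) (hJ : J.2 ≤ N) (hK : K.2 ≤ N)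
    (h : ∀ u ∈ U, (I.1 ≤ φ u ∧ φ u < I.2) ∨ (J.1 ≤ φ u ∧ φ u < J.2) ∨ (K.1 ≤ φ u ∧ φ u < K.2)) :
    Covers φ N U {I, J, K} := by
  refine ⟨fun {u} hu => ?_, fun {M} hM => ?_⟩
  · rcases h u hu with h | h | h
    exacts [⟨I, by simp, h⟩, ⟨J, by simp, h⟩, ⟨K, by simp, h⟩]
  · have : M = I ∨ M = J ∨ M = K := by simpa using hM
    rcases this with rfl | rfl | rfl <;> assumption

theorem covers_singleton {U : Set V} {I : ℕ × ℕ} (hI : I.2 ≤ N)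
    (h : ∀ u ∈ U, I.1 ≤ φ u ∧ φ u < I.2) : Covers φ N U {I} := by
  refine ⟨fun {u} hu => ⟨I, by simp, h u hu⟩, fun {K} hK => ?_⟩
  rwa [Multiset.mem_singleton.1 hK]

theorem cost_pair (I J : ℕ × ℕ) : cost {I, J} = runCost (I.2 - I.1) + runCost (J.2 - J.1) := by
  simp [Multiset.insert_eq_cons]

theorem cost_triple (I J K : ℕ × ℕ) :
    cost {I, J, K} = runCost (I.2 - I.1) + (runCost (J.2 - J.1) + runCost (K.2 - K.1)) := by
  simp [Multiset.insert_eq_cons]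

theorem runCost_le (r : ℕ) : runCost r ≤ r + 1 := by
  rw [runCost]
  omega

theorem runCost_eq_self {r : ℕ} (h : r % 4 = 0) : runCost r = r := by
  rw [runCost, h]
  rfl

theorem runCost_zero : runCost 0 = 0 := rfl

variable [Finite V]

/-- The end `i` of the chord and the vertices before it are separated from the rest, and `i` is
already dominated. -/
theorem IsChord.gameLength_le_of_mem (hc : IsChord G φ i j) (hφ : IsPathLabelling G φ N)
    (hij : i + 2 ≤ j) (hj : j < N) (hN : (N - i) % 4 = 0)
    (hm : (j - i) % 4 = 0 ∨ (j - i) % 4 = 1) {D : Set V} (hD : ∀ u, φ u = i → u ∈ D)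
    {s : Multiset (ℕ × ℕ)} (hs : Covers φ N {u | u ∉ D ∧ φ u < i + 1} s) :
    gameLength G .staller D ≤ (cost s + 1) / 2 + (N - i) / 2 := by
  obtain ⟨q, hq⟩ := hφ.exists_eq hj
  have hlike : ∀ A : Set V, IsPathLike G φ (A ∪ closedNeighborSet G q) := fun A =>
    hc.isPathLike hφ fun u hu => Or.inr ((hc.mem_closedNeighborSet_iff hφ).2 (by omega))
  have hlike' : ∀ v, (j ≤ φ v + 1 ∧ φ v ≤ j + 1) ∨ φ v = i →
      IsPathLike G φ ({u | φ u = i} ∪ closedNeighborSet G v) := fun v hv =>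
    hc.isPathLike hφ fun u hu => by
      rcases hu with hu | hu
      · exact Or.inl hu
      · exact Or.inr ((hc.mem_closedNeighborSet_iff hφ).2 (by omega))
  refine hφ.gameLength_staller_le_of_region (D₀ := {u | φ u = i}) (z := i + 1) (by omega) ?_ ?_ ?_
    hD hs
  · intro v w hw hwz hwi
    rw [Set.mem_ofPred_eq] at hwi
    rcases (hc.mem_closedNeighborSet_iff hφ).1 hw with h | h | h <;> omega
  · refine ⟨q, {(i + 1, j - 1), (j + 2, N)},
      covers_pair (by dsimp only; omega) le_rfl fun u hu => ?_, ?_, hlike _⟩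
    · rw [Set.mem_sdiff, Set.mem_ofPred_eq, hc.mem_closedNeighborSet_iff hφ] at hu
      have := hφ.lt u
      dsimp only
      omega
    · rw [cost_pair]
      simp only [runCost]
      omega
  · intro v w hw hwz
    have hvN := hφ.lt v
    have hvi : i ≤ φ v := by
      rcases (hc.mem_closedNeighborSet_iff hφ).1 hw with h | h | h <;> omega
    have h1 : φ v = i ∨ φ v + 1 = j ∨ φ v = j ∨ φ v = j + 1 ∨
      (i < φ v ∧ φ v + 1 < j) ∨ j + 1 < φ v := by omega
    rcases h1 with h | h | h | h | h | h
    · refine hφ.exists_reply (L := {(i + 2, j), (j + 1, N)})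
        (covers_pair (by dsimp only; omega) le_rfl fun u hu => ?_) (hlike' v (by omega)) ?_
      · rw [Set.mem_sdiff, Set.mem_ofPred_eq, hc.mem_closedNeighborSet_iff hφ] at hu
        have := hφ.lt u
        dsimp only
        omega
      · rw [cost_pair]
        have := runCost_le (j - (i + 2))
        have := runCost_le (N - (j + 1))
        -- Here the gain must be 3. The condition on `j - i` makes one of the two runs have length 2
        -- mod 4.
        rcases hm with hm | hm
        · exact ⟨(i + 2, j), by simp, by dsimp only; omega, Or.inr (by dsimp only; omega)⟩
        · exact ⟨(j + 1, N), by simp, by dsimp only; omega, Or.inr (by dsimp only; omega)⟩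
    · refine hφ.exists_reply (L := {(i + 1, j - 2), (j + 1, N)})
        (covers_pair (by dsimp only; omega) le_rfl fun u hu => ?_) (hlike' v (by omega)) ?_
      · rw [Set.mem_sdiff, Set.mem_ofPred_eq, hc.mem_closedNeighborSet_iff hφ] at hu
        have := hφ.lt u
        dsimp only
        omega
      · rw [cost_pair]
        have := runCost_le (j - 2 - (i + 1))
        have := runCost_le (N - (j + 1))
        exact ⟨(j + 1, N), by simp, by dsimp only; omega, Or.inl (by dsimp only; omega)⟩
    · refine hφ.exists_reply (L := {(i + 1, j - 1), (j + 2, N)})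
        (covers_pair (by dsimp only; omega) le_rfl fun u hu => ?_) (hlike' v (by omega)) ?_
      · rw [Set.mem_sdiff, Set.mem_ofPred_eq, hc.mem_closedNeighborSet_iff hφ] at hu
        have := hφ.lt u
        dsimp only
        omega
      · rw [cost_pair]
        have := runCost_le (j - 1 - (i + 1))
        have := runCost_le (N - (j + 2))
        exact ⟨(i + 1, j - 1), by simp, by dsimp only; omega, Or.inl (by dsimp only; omega)⟩
    · refine hφ.exists_reply (L := {(i + 1, j), (j + 3, N)})
        (covers_pair (by dsimp only; omega) le_rfl fun u hu => ?_) (hlike' v (by omega)) ?_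
      · rw [Set.mem_sdiff, Set.mem_ofPred_eq, hc.mem_closedNeighborSet_iff hφ] at hu
        have := hφ.lt u
        dsimp only
        omega
      · rw [cost_pair]
        have := runCost_le (j - (i + 1))
        have := runCost_le (N - (j + 3))
        exact ⟨(i + 1, j), by simp, by dsimp only; omega, Or.inl (by dsimp only; omega)⟩
    · refine ⟨q, {(i + 1, φ v - 1), (φ v + 2, j - 1), (j + 2, N)}, covers_triple
        (by dsimp only; omega) (by dsimp only; omega) le_rfl fun u hu => ?_, ?_, hlike _⟩
      · rw [Set.mem_sdiff, Set.mem_sdiff, Set.mem_ofPred_eq, hc.mem_closedNeighborSet_iff hφ,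
          hc.mem_closedNeighborSet_iff hφ] at hu
        have := hφ.lt u
        dsimp only
        omega
      · rw [cost_triple]
        dsimp only
        have hx := runCost_le (φ v - 1 - (i + 1))
        have hy := runCost_le (j - 1 - (φ v + 2))
        have hz := runCost_le (N - (j + 2))
        -- A move next to a dominated vertex takes one vertex fewer, but it also leaves one piece
        -- fewer. Both ends at once would give `j - i = 3`, which `hm` excludes.
        rcases eq_or_ne (φ v) (i + 1) with h1 | h1
        · rw [show φ v - 1 - (i + 1) = 0 by omega, runCost_zero] at *
          omega
        rcases eq_or_ne (φ v + 2) j with h2 | h2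
        · rw [show j - 1 - (φ v + 2) = 0 by omega, runCost_zero] at *
          omega
        omega
    · refine ⟨q, {(i + 1, j - 1), (j + 2, φ v - 1), (φ v + 2, N)}, covers_triple
        (by dsimp only; omega) (by dsimp only; omega) le_rfl fun u hu => ?_, ?_, hlike _⟩
      · rw [Set.mem_sdiff, Set.mem_sdiff, Set.mem_ofPred_eq, hc.mem_closedNeighborSet_iff hφ,
          hc.mem_closedNeighborSet_iff hφ] at hu
        have := hφ.lt u
        dsimp only
        omega
      · rw [cost_triple]
        dsimp only
        have hx := runCost_le (j - 1 - (i + 1))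
        have hy := runCost_le (φ v - 1 - (j + 2))
        have hz := runCost_le (N - (φ v + 2))
        rcases eq_or_ne (φ v) (j + 2) with h1 | h1
        · rw [show φ v - 1 - (j + 2) = 0 by omega, runCost_zero] at *
          rcases eq_or_ne (φ v + 1) N with h2 | h2
          · rw [show N - (φ v + 2) = 0 by omega, runCost_zero] at *
            omega
          · omega
        rcases eq_or_ne (φ v + 1) N with h2 | h2
        · rw [show N - (φ v + 2) = 0 by omega, runCost_zero] at *
          omega
        omega

/-- The vertices before the end `i` of the chord are separated from the rest, which is not yet
dominated. -/
theorem IsChord.gameLength_le_of_pred_mem (hc : IsChord G φ i j) (hφ : IsPathLabelling G φ N)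
    (hij : i + 2 ≤ j) (hj : j < N) (hi : 1 ≤ i) (hN : (N - j) % 4 = 0) (hm : (j - i) % 2 = 1)
    {D : Set V} {s : Multiset (ℕ × ℕ)} (hs : Covers φ N {u | u ∉ D ∧ φ u < i} s) :
    gameLength G .staller D ≤ (cost s + 1) / 2 + (N - i + 1) / 2 := by
  obtain ⟨q, hq⟩ := hφ.exists_eq hj
  have hlike : ∀ A : Set V, IsPathLike G φ (A ∪ closedNeighborSet G q) := fun A =>
    hc.isPathLike hφ fun u hu => Or.inr ((hc.mem_closedNeighborSet_iff hφ).2 (by omega))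
  have hlike' : ∀ v, φ v = i ∨ φ v = j → IsPathLike G φ (∅ ∪ closedNeighborSet G v) :=
    fun v hv => hc.isPathLike hφ fun u hu =>
      Or.inr ((hc.mem_closedNeighborSet_iff hφ).2 (by omega))
  refine hφ.gameLength_staller_le_of_region (D₀ := ∅) (z := i) (by omega) ?_ ?_ ?_
    (Set.empty_subset _) hs
  · intro v w hw hwz _
    rcases (hc.mem_closedNeighborSet_iff hφ).1 hw with h | h | h <;> omega
  · refine ⟨q, {(i + 1, j - 1), (j + 2, N)},
      covers_pair (by dsimp only; omega) le_rfl fun u hu => ?_, ?_, hlike _⟩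
    · rw [Set.mem_sdiff, Set.mem_ofPred_eq, hc.mem_closedNeighborSet_iff hφ] at hu
      have := hφ.lt u
      dsimp only
      omega
    · rw [cost_pair]
      have := runCost_le (j - 1 - (i + 1))
      have := runCost_le (N - (j + 2))
      dsimp only
      omega
  · intro v w hw hwz
    have hvN := hφ.lt v
    have hvi : i ≤ φ v + 1 := by
      rcases (hc.mem_closedNeighborSet_iff hφ).1 hw with h | h | h <;> omega
    have h1 : φ v + 1 = i ∨ φ v = i ∨ φ v = j ∨ (i < φ v ∧ φ v < j) ∨ j < φ v := by omega
    rcases h1 with h | h | h | h | h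
    · have hlast : ∀ p, j ≤ φ p + 1 ∧ φ p ≤ j + 1 →
          IsPathLike G φ (∅ ∪ closedNeighborSet G v ∪ closedNeighborSet G p) := fun p hp =>
        hc.isPathLike hφ fun u hu => by
          rcases hu with hu | hu
          · exact Or.inl (Or.inr ((hc.mem_closedNeighborSet_iff hφ).2 (by omega)))
          · exact Or.inr ((hc.mem_closedNeighborSet_iff hφ).2 (by omega))
      -- Staller has dominated only `i` in the region, so the reply must dominate `j`. It is played
      -- at the neighbour of `j` for which the run between the chord ends gets length divisible by
      -- 4.
      have h1 : (j - i) % 4 = 1 ∨ (j - i) % 4 = 3 := by omega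
      rcases h1 with h1 | h1
      · obtain ⟨p, hp⟩ := hφ.exists_eq (k := j + 1) (by omega)
        refine ⟨p, {(i + 1, j), (j + 3, N)}, covers_pair (by dsimp only; omega) le_rfl
          fun u hu => ?_, ?_, hlast p (by omega)⟩
        · rw [Set.mem_sdiff, Set.mem_sdiff, Set.mem_ofPred_eq, hc.mem_closedNeighborSet_iff hφ,
            hc.mem_closedNeighborSet_iff hφ] at hu
          have := hφ.lt u
          dsimp only
          omega
        · rw [cost_pair]
          simp only [runCost]
          omega
      · obtain ⟨p, hp⟩ := hφ.exists_eq (k := j - 1) (by omega)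
        refine ⟨p, {(i + 1, j - 2), (j + 1, N)}, covers_pair (by dsimp only; omega) le_rfl
          fun u hu => ?_, ?_, hlast p (by omega)⟩
        · rw [Set.mem_sdiff, Set.mem_sdiff, Set.mem_ofPred_eq, hc.mem_closedNeighborSet_iff hφ,
            hc.mem_closedNeighborSet_iff hφ] at hu
          have := hφ.lt u
          dsimp only
          omega
        · rw [cost_pair]
          simp only [runCost]
          omega
    · refine hφ.exists_reply (L := {(i + 2, j), (j + 1, N)})
        (covers_pair (by dsimp only; omega) le_rfl fun u hu => ?_) (hlike' v (by omega)) ?_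
      · rw [Set.mem_sdiff, Set.mem_ofPred_eq, hc.mem_closedNeighborSet_iff hφ] at hu
        have := hφ.lt u
        dsimp only
        omega
      · rw [cost_pair]
        have := runCost_le (j - (i + 2))
        have := runCost_le (N - (j + 1))
        exact ⟨(j + 1, N), by simp, by dsimp only; omega, Or.inl (by dsimp only; omega)⟩
    · refine hφ.exists_reply (L := {(i + 1, j - 1), (j + 2, N)})
        (covers_pair (by dsimp only; omega) le_rfl fun u hu => ?_) (hlike' v (by omega)) ?_
      · rw [Set.mem_sdiff, Set.mem_ofPred_eq, hc.mem_closedNeighborSet_iff hφ] at hu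
        have := hφ.lt u
        dsimp only
        omega
      · rw [cost_pair]
        have := runCost_le (j - 1 - (i + 1))
        have := runCost_le (N - (j + 2))
        exact ⟨(j + 2, N), by simp, by dsimp only; omega, Or.inl (by dsimp only; omega)⟩
    · refine ⟨q, {(i + 1, φ v - 1), (φ v + 2, j - 1), (j + 2, N)}, covers_triple
        (by dsimp only; omega) (by dsimp only; omega) le_rfl fun u hu => ?_, ?_, hlike _⟩
      · rw [Set.mem_sdiff, Set.mem_sdiff, Set.mem_ofPred_eq, hc.mem_closedNeighborSet_iff hφ,
          hc.mem_closedNeighborSet_iff hφ] at hu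
        have := hφ.lt u
        dsimp only
        omega
      · rw [cost_triple]
        dsimp only
        have hx := runCost_le (φ v - 1 - (i + 1))
        have hy := runCost_le (j - 1 - (φ v + 2))
        have hz := runCost_le (N - (j + 2))
        rcases eq_or_ne (φ v) (i + 1) with h1 | h1
        · rw [show φ v - 1 - (i + 1) = 0 by omega, runCost_zero] at *
          rcases le_or_gt (j - 1) (φ v + 2) with h2 | h2
          · rw [show j - 1 - (φ v + 2) = 0 by omega, runCost_zero] at *
            omega
          · omega
        rcases le_or_gt (j - 1) (φ v + 2) with h2 | h2
        · rw [show j - 1 - (φ v + 2) = 0 by omega, runCost_zero] at *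
          omega
        omega
    · refine ⟨q, {(i + 1, j - 1), (j + 2, φ v - 1), (φ v + 2, N)}, covers_triple
        (by dsimp only; omega) (by dsimp only; omega) le_rfl fun u hu => ?_, ?_, hlike _⟩
      · rw [Set.mem_sdiff, Set.mem_sdiff, Set.mem_ofPred_eq, hc.mem_closedNeighborSet_iff hφ,
          hc.mem_closedNeighborSet_iff hφ] at hu
        have := hφ.lt u
        dsimp only
        omega
      · rw [cost_triple]
        dsimp only
        have hx := runCost_le (j - 1 - (i + 1))
        have hy := runCost_le (φ v - 1 - (j + 2))
        have hz := runCost_le (N - (φ v + 2))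
        rcases le_or_gt (φ v) (j + 2) with h1 | h1
        · rw [show φ v - 1 - (j + 2) = 0 by omega, runCost_zero] at *
          omega
        rcases eq_or_ne (φ v + 1) N with h2 | h2
        · rw [show N - (φ v + 2) = 0 by omega, runCost_zero] at *
          omega
        omega

end Chord

/-! ### The first move of Dominator -/

section GameDominationNumber

variable {V : Type*} {G : SimpleGraph V} {φ : V → ℕ} {N i j : ℕ}

theorem IsPathLabelling.reverse (hφ : IsPathLabelling G φ N) :
    IsPathLabelling G (fun v => N - 1 - φ v) N where
  injective u v h := hφ.injective (by
    have := hφ.lt u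
    have := hφ.lt v
    dsimp only at h
    omega)
  lt v := by
    have := hφ.lt v
    omega
  exists_eq {k} hk := by
    obtain ⟨v, hv⟩ := hφ.exists_eq (k := N - 1 - k) (by omega)
    exact ⟨v, by omega⟩
  adj {u v} h := (hφ.adj (by
    have := hφ.lt u
    have := hφ.lt v
    omega)).symm

theorem IsChord.reverse (hc : IsChord G φ i j) (hφ : IsPathLabelling G φ N) (hi : i < N)
    (hj : j < N) : IsChord G (fun v => N - 1 - φ v) (N - 1 - j) (N - 1 - i) where
  adj {u v} hu hv := by
    have := hφ.lt u
    have := hφ.lt v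
    exact (hc.adj (u := v) (v := u) (by omega) (by omega)).symm
  eq_of_adj {u v} h := by
    have := hφ.lt u
    have := hφ.lt v
    have := hc.eq_of_adj h
    omega

variable [Finite V]

/-- A condition under which Dominator wins fast, starting close to the end `i` of the chord. -/
theorem IsChord.gameDominationNumber_le_of (hc : IsChord G φ i j) (hφ : IsPathLabelling G φ N)
    (hij : i + 2 ≤ j) (hj : j < N)
    (h : N % 2 = 1 ∨
      runCost (i - 1) + runCost (j - (i + 2)) + runCost (N - (j + 1)) + 2 ≤ N ∨
      runCost (i - 1) + runCost (N - (i + 2)) + 2 ≤ N ∨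
      (i % 4 = 2 ∧ (N - i) % 4 = 0 ∧ ((j - i) % 4 = 0 ∨ (j - i) % 4 = 1)) ∨
      (i % 4 = 3 ∧ (N - j) % 4 = 0 ∧ (j - i) % 2 = 1)) :
    gameDominationNumber G ≤ (N + 1) / 2 := by
  obtain ⟨p, hp⟩ := hφ.exists_eq (k := i) (by omega)
  have hlike : IsPathLike G φ (∅ ∪ closedNeighborSet G p) :=
    hc.isPathLike hφ fun u hu => Or.inr ((hc.mem_closedNeighborSet_iff hφ).2 (by omega))
  have hp₁ := gameLength_dominator_le (G := G) ∅ p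
  have htriple := hφ.gameLength_staller_le hlike (L := {(0, i - 1), (i + 2, j), (j + 1, N)})
    (covers_triple (by dsimp only; omega) (by dsimp only; omega) le_rfl fun u hu => by
      rw [Set.mem_compl_iff, Set.empty_union, hc.mem_closedNeighborSet_iff hφ] at hu
      have := hφ.lt u
      dsimp only
      omega)
  rw [cost_triple] at htriple
  dsimp only at htriple
  rw [gameDominationNumber]
  rcases h with h | h | h | ⟨h, hN, hm⟩ | ⟨h, hN, hm⟩
  · have hx := runCost_le (i - 1 - 0)
    have hy := runCost_le (j - (i + 2))
    have hz := runCost_le (N - (j + 1))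
    rcases Nat.eq_zero_or_pos i with h0 | h0
    · rw [show i - 1 - 0 = 0 by omega, runCost_zero] at *
      omega
    · omega
  · rw [Nat.sub_zero] at htriple
    omega
  -- Forgetting that `j` is dominated merges two runs: one more vertex to count, but one rounding
  -- unit fewer.
  · have hpair := hφ.gameLength_staller_le hlike (L := {(0, i - 1), (i + 2, N)})
      (covers_pair (by dsimp only; omega) le_rfl fun u hu => by
        rw [Set.mem_compl_iff, Set.empty_union, hc.mem_closedNeighborSet_iff hφ] at hu
        have := hφ.lt u
        dsimp only
        omega)
    rw [cost_pair] at hpair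
    dsimp only at hpair
    rw [Nat.sub_zero] at hpair
    omega
  -- This dominates `i` and leaves `i - 2` vertices on the left, a multiple of 4.
  · obtain ⟨q, hq⟩ := hφ.exists_eq (k := i - 1) (by omega)
    have hq₁ := gameLength_dominator_le (G := G) ∅ q
    have := hc.gameLength_le_of_mem hφ hij hj hN hm (D := ∅ ∪ closedNeighborSet G q)
      (fun u hu => Or.inr ((hc.mem_closedNeighborSet_iff hφ).2 (by omega))) (s := {(0, i - 2)})
      (covers_singleton (by dsimp only; omega) fun u hu => by
        rw [Set.mem_ofPred_eq, Set.empty_union, hc.mem_closedNeighborSet_iff hφ] at hu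
        dsimp only
        omega)
    rw [cost_singleton, runCost] at this
    dsimp only at this
    omega
  -- This stops just short of `i` and leaves `i - 3` vertices on the left, a multiple of 4.
  · obtain ⟨q, hq⟩ := hφ.exists_eq (k := i - 2) (by omega)
    have hq₁ := gameLength_dominator_le (G := G) ∅ q
    have := hc.gameLength_le_of_pred_mem hφ hij hj (by omega) hN hm
      (D := ∅ ∪ closedNeighborSet G q) (s := {(0, i - 3)})
      (covers_singleton (by dsimp only; omega) fun u hu => by
        rw [Set.mem_ofPred_eq, Set.empty_union, hc.mem_closedNeighborSet_iff hφ] at hu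
        dsimp only
        omega)
    rw [cost_singleton, runCost] at this
    dsimp only at this
    omega

/-- One of the openings works for the labelling or for its reverse. With `i` vertices before the
chord, `k + 1` strictly between its ends and `b` after it, this is a finite check of residues mod 4.
-/
theorem IsChord.gameDominationNumber_le (hc : IsChord G φ i j) (hφ : IsPathLabelling G φ N)
    (hij : i + 2 ≤ j) (hj : j < N) : gameDominationNumber G ≤ (N + 1) / 2 := by
  by_contra hcon
  have h := mt (hc.gameDominationNumber_le_of hφ hij hj) hcon
  have h' := mt ((hc.reverse hφ (by omega) hj).gameDominationNumber_le_of hφ.reverse (by omega)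
    (by omega)) hcon
  clear hcon
  obtain ⟨k, rfl⟩ := Nat.exists_eq_add_of_le hij
  obtain ⟨b, rfl⟩ := Nat.exists_eq_add_of_lt hj
  rw [show i + 2 + k + b + 1 - (i + 2 + k + 1) = b by omega,
    show i + 2 + k - (i + 2) = k by omega, show i + 2 + k + b + 1 - (i + 2) = k + b + 1 by omega,
    show i + 2 + k + b + 1 - (i + 2 + k) = b + 1 by omega,
    show i + 2 + k + b + 1 - i = k + b + 3 by omega, show i + 2 + k - i = k + 2 by omega] at h
  rw [show i + 2 + k + b + 1 - 1 - (i + 2 + k) = b by omega,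
    show i + 2 + k + b + 1 - 1 - i = k + b + 2 by omega, show k + b + 2 - (b + 2) = k by omega,
    show i + 2 + k + b + 1 - (k + b + 2 + 1) = i by omega,
    show i + 2 + k + b + 1 - (b + 2) = k + i + 1 by omega,
    show i + 2 + k + b + 1 - (k + b + 2) = i + 1 by omega,
    show i + 2 + k + b + 1 - b = k + i + 3 by omega, show k + b + 2 - b = k + 2 by omega] at h'
  simp only [not_or] at h h'
  obtain ⟨hN, hF, hE, hK, hM⟩ := h
  obtain ⟨-, hF', hE', hK', -⟩ := h'
  clear hc hφ hij hj
  have h2 := runCost_le k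
  have hi0 : 0 < i := by
    by_contra h0
    obtain rfl : i = 0 := by omega
    have h5 := runCost_le (b - 1)
    rw [runCost_zero] at hF'
    clear hK hK' hM hE hE'
    rcases Nat.eq_zero_or_pos b with rfl | hb0
    · rw [Nat.zero_sub, runCost_zero] at hF'
      omega
    · omega
  have hb0 : 0 < b := by
    by_contra h0
    obtain rfl : b = 0 := by omega
    have h1 := runCost_le (i - 1)
    rw [runCost_zero] at hF
    clear hK hK' hM hE hE'
    omega
  have h3 := runCost_le b
  have h6 := runCost_le i
  have h1 := runCost_le (i - 1)
  have h5 := runCost_le (b - 1)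
  have h4 := runCost_le (k + b + 1)
  have h7 := runCost_le (k + i + 1)
  -- A run of length divisible by 4 would save the one unit missing in the bounds for an opening at
  -- a chord end.
  have hres : i % 4 ≠ 0 ∧ (i - 1) % 4 ≠ 0 ∧ b % 4 ≠ 0 ∧ (b - 1) % 4 ≠ 0 ∧ k % 4 ≠ 0 ∧
      (k + b + 1) % 4 ≠ 0 ∧ (k + i + 1) % 4 ≠ 0 := by
    clear hK hK' hM
    refine ⟨?_, ?_, ?_, ?_, ?_, ?_, ?_⟩ <;> intro h0 <;> have := runCost_eq_self h0 <;>
      clear h0 <;> omega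
  clear hF hF' hE hE' h1 h2 h3 h4 h5 h6 h7
  have hi : i % 4 = 2 ∨ i % 4 = 3 := by omega
  have hb : b % 4 = 2 ∨ b % 4 = 3 := by omega
  have hk : k % 4 = 1 ∨ k % 4 = 2 ∨ k % 4 = 3 := by omega
  rcases hi with hi | hi <;> rcases hb with hb | hb <;> rcases hk with hk | hk | hk <;> omega

/-- The game on a path. -/
theorem IsPathLabelling.gameDominationNumber_le (hφ : IsPathLabelling G φ N) (hN : 0 < N)
    (h : ∀ u v, G.Adj u v → φ u + 1 = φ v ∨ φ v + 1 = φ u) :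
    gameDominationNumber G ≤ (N + 1) / 2 := by
  -- The second vertex, or the only one if `N = 1`.
  obtain ⟨p, hp⟩ := hφ.exists_eq (k := min 1 (N - 1)) (by omega)
  have hlike : IsPathLike G φ (∅ ∪ closedNeighborSet G p) := by
    rintro v w (rfl | hw) -
    · omega
    · have := h _ _ hw
      omega
  have h₁ := gameLength_dominator_le (G := G) ∅ p
  have h₂ := hφ.gameLength_staller_le hlike (L := {(3, N)})
    (covers_singleton le_rfl fun u hu => by
      rw [Set.mem_compl_iff, Set.empty_union] at hu
      have := hφ.lt u
      dsimp only
      by_contra hlt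
      exact hu (hφ.mem_closedNeighborSet (by omega) (by omega)))
  rw [cost_singleton, runCost] at h₂
  dsimp only at h₂
  rw [gameDominationNumber]
  omega

end GameDominationNumber

/-! ### Two-tailed tadpoles -/

/-- The position of a vertex of the two-tailed tadpole on its Hamiltonian path. -/
def tadpoleLabel (m n k : ℕ) : Fin m ⊕ Fin n ⊕ Fin k → ℕ
  | .inl i => if i.val = 0 then n else n + (m - i.val)
  | .inr (.inl j) => n - 1 - j.val
  | .inr (.inr j) => n + m + j.val

/-- The Hamiltonian path runs up one tail, the long way round the cycle and out along the other
tail; the chord is the cycle edge between the two attachment vertices. -/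
theorem twoTailedTadpole_adj_iff {m n k : ℕ} (hm : 3 ≤ m) (u v : Fin m ⊕ Fin n ⊕ Fin k) :
    (twoTailedTadpole m n k).Adj u v ↔
      tadpoleLabel m n k u + 1 = tadpoleLabel m n k v ∨
      tadpoleLabel m n k v + 1 = tadpoleLabel m n k u ∨
      (tadpoleLabel m n k u = n ∧ tadpoleLabel m n k v = n + m - 1) ∨
      (tadpoleLabel m n k u = n + m - 1 ∧ tadpoleLabel m n k v = n) := by
  rcases u with ⟨u, hu⟩ | ⟨u, hu⟩ | ⟨u, hu⟩ <;> rcases v with ⟨v, hv⟩ | ⟨v, hv⟩ | ⟨v, hv⟩ <;>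
    simp only [twoTailedTadpole, tadpoleLabel, SimpleGraph.sup_adj, SimpleGraph.sum_adj,
      SimpleGraph.fromRel_adj, SimpleGraph.pathGraph_adj, SimpleGraph.cycleGraph_adj', Fin.sub_def,
      ne_eq, reduceCtorEq, not_false_eq_true, true_and, and_false, or_false, false_or, or_self]
  · have h₁ : (m - v + u) % m = if v ≤ u then u - v else m - v + u := by
      split_ifs with h
      · rw [show m - v + u = u - v + m by omega, Nat.add_mod_right, Nat.mod_eq_of_lt (by omega)]
      · exact Nat.mod_eq_of_lt (by omega)
    have h₂ : (m - u + v) % m = if u ≤ v then v - u else m - u + v := by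
      split_ifs with h
      · rw [show m - u + v = v - u + m by omega, Nat.add_mod_right, Nat.mod_eq_of_lt (by omega)]
      · exact Nat.mod_eq_of_lt (by omega)
    rw [h₁, h₂]
    split_ifs <;> omega
  all_goals first | omega | (rw [false_iff]; omega) | (split_ifs <;> omega)

theorem isPathLabelling_tadpoleLabel {m n k : ℕ} (hm : 3 ≤ m) :
    IsPathLabelling (twoTailedTadpole m n k) (tadpoleLabel m n k) (n + m + k) where
  injective u v h := by
    rcases u with ⟨u, hu⟩ | ⟨u, hu⟩ | ⟨u, hu⟩ <;> rcases v with ⟨v, hv⟩ | ⟨v, hv⟩ | ⟨v, hv⟩ <;>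
      simp only [tadpoleLabel, Sum.inl.injEq, Sum.inr.injEq, Fin.mk.injEq, reduceCtorEq] at h ⊢ <;>
      first | omega | (split_ifs at h <;> omega)
  lt u := by
    rcases u with ⟨u, hu⟩ | ⟨u, hu⟩ | ⟨u, hu⟩ <;> simp only [tadpoleLabel] <;>
      first | omega | (split_ifs <;> omega)
  exists_eq {l} hl := by
    rcases lt_or_ge l n with h | h
    · exact ⟨.inr (.inl ⟨n - 1 - l, by omega⟩), by simp only [tadpoleLabel]; omega⟩
    rcases lt_or_ge l (n + m) with h' | h'
    · rcases h.eq_or_lt with rfl | h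
      · exact ⟨.inl ⟨0, by omega⟩, by simp [tadpoleLabel]⟩
      · refine ⟨.inl ⟨n + m - l, by omega⟩, ?_⟩
        simp only [tadpoleLabel]
        rw [if_neg (by omega)]
        omega
    · exact ⟨.inr (.inr ⟨l - (n + m), by omega⟩), by simp only [tadpoleLabel]; omega⟩
  adj h := (twoTailedTadpole_adj_iff hm _ _).2 (Or.inl h)

theorem isChord_tadpoleLabel {m n k : ℕ} (hm : 3 ≤ m) :
    IsChord (twoTailedTadpole m n k) (tadpoleLabel m n k) n (n + m - 1) where
  adj hu hv := (twoTailedTadpole_adj_iff hm _ _).2 (Or.inr (Or.inr (Or.inl ⟨hu, hv⟩)))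
  eq_of_adj h := (twoTailedTadpole_adj_iff hm _ _).1 h

theorem gameDominationNumber_twoTailedTadpole_le {m n k : ℕ} (hm : 3 ≤ m) :
    gameDominationNumber (twoTailedTadpole m n k) ≤ (n + m + k + 1) / 2 :=
  (isChord_tadpoleLabel hm).gameDominationNumber_le (isPathLabelling_tadpoleLabel hm) (by omega)
    (by omega)

/-! ### Traceable unicyclic graphs -/

section Unicyclic

open SimpleGraph

variable {V : Type*} {G : SimpleGraph V}

/-- An edge outside a walk through all vertices lies on a cycle whose other edges belong to the
walk. -/
theorem exists_isCycle_of_notMem_edges {a b : V} (p : G.Walk a b) (hp : ∀ w, w ∈ p.support)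
    {u v : V} (h : G.Adj u v) (huv : s(u, v) ∉ p.edges) :
    ∃ c : G.Walk u u, c.IsCycle ∧ s(u, v) ∈ c.edges ∧
      ∀ e ∈ c.edges, e = s(u, v) ∨ e ∈ p.edges := by
  classical
  set q := ((p.takeUntil v (hp v)).reverse.append (p.takeUntil u (hp u))).bypass with hq
  have hsub : ∀ e ∈ q.edges, e ∈ p.edges := fun e he => by
    have := Walk.edges_bypass_subset_edges _ he
    rw [Walk.edges_append, List.mem_append, Walk.edges_reverse, List.mem_reverse] at this
    rcases this with h | h <;> exact Walk.edges_takeUntil_subset_edges _ _ h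
  refine ⟨Walk.cons h q, (Walk.cons_isCycle_iff q h).2
    ⟨Walk.bypass_isPath _, fun he => huv (hsub _ he)⟩, by simp, fun e he => ?_⟩
  rw [Walk.edges_cons, List.mem_cons] at he
  exact he.imp id (hsub e)

/-- Each edge off the walk lies on a cycle with no other edge off the walk. These cycles coincide,
hence so do the edges. -/
theorem IsUnicyclic.eq_of_notMem_edges (hG : IsUnicyclic G) {a b : V} (p : G.Walk a b)
    (hp : ∀ w, w ∈ p.support) {e f : Sym2 V} (he : e ∈ G.edgeSet) (hf : f ∈ G.edgeSet)
    (hep : e ∉ p.edges) (hfp : f ∉ p.edges) : e = f := by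
  induction e using Sym2.ind with
  | _ u v =>
  induction f using Sym2.ind with
  | _ x y =>
    obtain ⟨c, hc, hec, -⟩ := exists_isCycle_of_notMem_edges p hp he hep
    obtain ⟨d, hd, -, hd'⟩ := exists_isCycle_of_notMem_edges p hp hf hfp
    have heq := hG.2.unique ⟨u, c, hc, rfl⟩ ⟨x, d, hd, rfl⟩
    have hed : s(u, v) ∈ {e | e ∈ d.edges} := heq ▸ hec
    exact (hd' _ hed).resolve_right hep

theorem exists_isPathLabelling {a b : V} {p : G.Walk a b} (hp : p.IsPath)
    (hsupp : ∀ w, w ∈ p.support) :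
    ∃ φ : V → ℕ, IsPathLabelling G φ (p.length + 1) ∧
      ∀ u v, s(u, v) ∈ p.edges → φ u + 1 = φ v ∨ φ v + 1 = φ u := by
  have hex : ∀ v, ∃ k, p.getVert k = v ∧ k ≤ p.length := fun v =>
    Walk.mem_support_iff_exists_getVert.1 (hsupp v)
  choose φ hφ hle using hex
  have hval : ∀ k, k ≤ p.length → φ (p.getVert k) = k := fun k hk =>
    hp.getVert_injOn (hle _) hk (hφ _)
  refine ⟨φ, ⟨fun u v h => ?_, fun v => Nat.lt_succ_of_le (hle v),
    fun {k} hk => ⟨p.getVert k, hval k (by omega)⟩, fun {u v} h => ?_⟩, fun u v h => ?_⟩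
  · rw [← hφ u, ← hφ v, h]
  · rw [← hφ u, ← hφ v, ← h]
    refine p.adj_getVert_succ ?_
    have := hle v
    omega
  · obtain ⟨k, hk, he⟩ := p.mk_mem_edges_iff_exists.1 h
    have h₁ := hval k hk.le
    have h₂ := hval (k + 1) hk
    rcases Sym2.eq_iff.1 he with ⟨rfl, rfl⟩ | ⟨rfl, rfl⟩ <;> omega

theorem IsUnicyclic.gameDominationNumber_le [Finite V] (hG : IsUnicyclic G) (ht : IsTraceable G) :
    gameDominationNumber G ≤ (Nat.card V + 1) / 2 := by
  classical
  obtain ⟨a, b, p, hp⟩ := ht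
  have := Fintype.ofFinite V
  have hsupp : ∀ w, w ∈ p.support := fun w => List.one_le_count_iff.1 (hp w).ge
  have hpath : p.IsPath := Walk.IsPath.mk' (List.nodup_iff_count_le_one.2 fun w => (hp w).le)
  obtain ⟨φ, hφ, hedge⟩ := exists_isPathLabelling hpath hsupp
  have hcard : Nat.card V = p.length + 1 := by
    rw [← Nat.card_fin (p.length + 1)]
    refine Nat.card_congr (Equiv.ofBijective (fun v => ⟨φ v, hφ.lt v⟩) ⟨fun u v h => ?_, ?_⟩)
    · exact hφ.injective (Fin.ext_iff.1 h)
    · rintro ⟨k, hk⟩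
      obtain ⟨v, hv⟩ := hφ.exists_eq hk
      exact ⟨v, Fin.ext hv⟩
  rw [hcard]
  by_cases hex : ∃ x y, G.Adj x y ∧ s(x, y) ∉ p.edges ∧ φ x + 2 ≤ φ y
  · obtain ⟨x, y, hxy, hnot, hlt⟩ := hex
    refine IsChord.gameDominationNumber_le (i := φ x) (j := φ y)
      ⟨fun {u v} hu hv => ?_, fun {u v} huv => ?_⟩ hφ hlt (hφ.lt y)
    · rwa [hφ.injective hu, hφ.injective hv]
    · by_cases hm : s(u, v) ∈ p.edges
      · have := hedge u v hm
        omega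
      · have := hG.eq_of_notMem_edges p hsupp (e := s(u, v)) (f := s(x, y)) huv hxy hm hnot
        rcases Sym2.eq_iff.1 this with ⟨rfl, rfl⟩ | ⟨rfl, rfl⟩ <;> omega
  -- Without a chord the graph would be a path. The cycle rules this out, but the bound for paths
  -- covers it anyway.
  · refine hφ.gameDominationNumber_le (Nat.succ_pos _) fun u v huv => ?_
    by_cases hm : s(u, v) ∈ p.edges
    · exact hedge u v hm
    · by_contra hcon
      have hne : φ u ≠ φ v := fun h => huv.ne (hφ.injective h)
      rcases lt_or_ge (φ u) (φ v) with h | h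
      · exact hex ⟨u, v, huv, hm, by omega⟩
      · exact hex ⟨v, u, huv.symm, by rwa [Sym2.eq_swap], by omega⟩

end Unicyclic

theorem le_ceil_half {g n : ℕ} (h : g ≤ (n + 1) / 2) : g ≤ ⌈(n : ℚ) / 2⌉₊ := by
  by_contra hlt
  have h₁ : (n : ℚ) / 2 ≤ ⌈(n : ℚ) / 2⌉₊ := Nat.le_ceil _
  have h₂ : n ≤ 2 * ⌈(n : ℚ) / 2⌉₊ := by
    rw [div_le_iff₀ two_pos] at h₁
    have : (n : ℚ) ≤ ((⌈(n : ℚ) / 2⌉₊ * 2 : ℕ) : ℚ) := by exact_mod_cast h₁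
    have := Nat.cast_le.1 this
    omega
  omega

end DominationGame

theorem theorem4p2 :
    (∀ m n k : ℕ, 3 ≤ m → 1 ≤ n → 1 ≤ k →
      DominationGame.gameDominationNumber (DominationGame.twoTailedTadpole m n k) ≤
        ⌈(Nat.card (Fin m ⊕ Fin n ⊕ Fin k) : ℚ) / 2⌉₊) ∧
    (∀ (V : Type*) [Finite V] (G : SimpleGraph V),
      DominationGame.IsUnicyclic G → DominationGame.IsTraceable G →
        DominationGame.gameDominationNumber G ≤ ⌈(Nat.card V : ℚ) / 2⌉₊) := by
  refine ⟨fun m n k hm _ _ => DominationGame.le_ceil_half ?_, fun V _ G hG ht =>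
    DominationGame.le_ceil_half (hG.gameDominationNumber_le ht)⟩
  have hcard : Nat.card (Fin m ⊕ Fin n ⊕ Fin k) = n + m + k := by
    simp only [Nat.card_eq_fintype_card, Fintype.card_sum, Fintype.card_fin]
    omega
  rw [hcard]
  exact DominationGame.gameDominationNumber_twoTailedTadpole_le hm
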